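/- For structures $\mathbf A,\mathbf B$ in a relational signature, let $\binom{\mathbf B}{\mathbf A}$ be the set of substructures of $\mathbf B$ isomorphic to $\mathbf A$. A class $\mathcal K$ of finite structures has the Ramsey property if for all $k\in\mathbb N$ and all $\mathbf A,\mathbf B\in\mathcal K$ there is $\mathbf C\in\mathcal K$ such that for every map $c:\binom{\mathbf C}{\mathbf A}\to\{0,\dots,k-1\}$ there is $\mathbf B'\in\binom{\mathbf C}{\mathbf B}$ such that $c$ takes at most one value on $\binom{\mathbf B'}{\mathbf A}$. The age of a structure is the class of finite structures that embed into it. Let $\mathcal P=(P,\prec)$ be the generic partial order, i.e. the (countable) Fraïssé limit of the class of all finite partial orders, and let $P=P_0\sqcup P_1\sqcup P_2$ be a partition into three dense subsets, where $D\subseteq P$ is dense if for all $x,z\in P$ with $x\prec z$ there is $y\in D$ with $x\prec y\prec z$. For a binary relation $X$ on $P$ let $T^X_{-1}=X$, let $T^X_1=\{(x,y):(y,x)\in X\}$, and let $T^X_0$ be the set of remaining pairs; indices are read modulo $3$. Let $\mathcal P(3)=(P,E)$ be the directed graph determined by $$(x,y)\in T^{E}_{k+(j-i)}\iff (x,y)\in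 T^{\prec}_k\qquad\text{for all } x\in P_i,\ y\in P_j,\ i,j,k\in\mathbb Z/3 .$$ Let $<$ be a linear extension of $\prec$ such that the structure $\mathcal P(3)^*=(P,E,P_0,P_1,P_2,<)$, with $E$ and $<$ binary and $P_0,P_1,P_2$ unary relations, is a Fraïssé structure, i.e. every isomorphism between finite substructures extends to an automorphism. Then the age of $\mathcal P(3)^*$ has the Ramsey property. -/

import Mathlib

open scoped FirstOrder
open CategoryTheory (Bundled)

universe u

/-! ### The Ramsey property of a class of structures -/

section Ramsey

variable (L : FirstOrder.Language.{0, 0})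

/-- The copies of `A` in `B`: the substructures of `B` that are isomorphic to `A`. -/
def copies (A B : Bundled.{u} L.Structure) : Set (L.Substructure B) :=
  {S | Nonempty (A ≃[L] S)}

/-- The arrow relation `C ⟶ (B)^A_{k,l}`: for every colouring of the copies of `A` in `C` with
`k` colours there is a copy `B'` of `B` in `C` such that at most `l` colours occur on the copies
of `A` that lie in `B'`. -/
def Arrows (C B A : Bundled.{u} L.Structure) (k l : ℕ) : Prop :=
  ∀ c : copies L A C → Fin k, ∃ B' ∈ copies L B C,
    (c '' {A' : copies L A C | (A' : L.Substructure C) ≤ B'}).encard ≤ l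

/-- The Ramsey property of a class of structures. -/
def RamseyProperty (K : Set (Bundled.{u} L.Structure)) : Prop :=
  ∀ k : ℕ, ∀ A ∈ K, ∀ B ∈ K, ∃ C ∈ K, Arrows L C B A k 1

end Ramsey

/-! ### The generic partial order and dense subsets -/

/-- A countable partial order is generic if it is the Fraïssé limit of the class of all finite
partial orders. -/
def IsGenericPartialOrder (P : Type u) [PartialOrder P] [Countable P] : Prop :=
  letI : FirstOrder.Language.order.Structure P := FirstOrder.Language.orderStructure P
  FirstOrder.Language.IsFraisseLimit
    {M : Bundled.{u} FirstOrder.Language.order.Structure |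
      Finite M ∧ M ⊨ FirstOrder.Language.order.partialOrderTheory} P

/-- A subset `D` of a partial order is dense if strictly between any two points `x < z` of
the order there is a point of `D`. -/
def IsDenseSubset {P : Type u} [PartialOrder P] (D : Set P) : Prop :=
  ∀ x z : P, x < z → ∃ y ∈ D, x < y ∧ y < z

/-! ### Twisting -/

/-- The relations `T_k^X`, with `k ∈ {-1, 0, 1}` read modulo 3: `T_{-1}` is `X`, `T_1` is the
converse of `X`, and `T_0` holds for the remaining pairs. -/
def TRel {V : Type u} (X : V → V → Prop) (k : ZMod 3) (x y : V) : Prop :=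
  (k = -1 ∧ X x y) ∨ (k = 1 ∧ X y x) ∨ (k = 0 ∧ ¬ X x y ∧ ¬ X y x)

/-- The digraph `P(3)`, obtained by twisting the strict order of `P` along `D 0, D 1, D 2`.
For `x ∈ D i` and `y ∈ D j` there is an edge from `x` to `y` if and only if
`T_k` holds of `(x, y)` in the strict order, where `k + (j - i) = -1` modulo 3. -/
def P3 {P : Type u} [PartialOrder P] (D : ZMod 3 → Set P) : Digraph P where
  Adj x y := ∃ i j k : ZMod 3, x ∈ D i ∧ y ∈ D j ∧ k + (j - i) = -1 ∧
    TRel (fun a b : P => a < b) k x y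

/-- The defining property of the edges of `P(3)`. -/
theorem P3_spec {P : Type u} [PartialOrder P] {D : ZMod 3 → Set P}
    (hD : ∀ x : P, ∃! i, x ∈ D i) {x y : P} {i j : ZMod 3} (hx : x ∈ D i) (hy : y ∈ D j)
    (k : ZMod 3) :
    TRel (P3 D).Adj (k + (j - i)) x y ↔ TRel (fun a b : P => a < b) k x y := by
  have key : ∀ {x y : P} {i j : ZMod 3}, x ∈ D i → y ∈ D j →
      ((P3 D).Adj x y ↔ TRel (fun a b : P => a < b) (-1 - (j - i)) x y) := by
    intro x y i j hx hy
    constructor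
    · rintro ⟨i', j', k, hx', hy', hk, h⟩
      obtain rfl := (hD x).unique hx hx'
      obtain rfl := (hD y).unique hy hy'
      rwa [← hk, add_sub_cancel_right]
    · intro h
      exact ⟨i, j, _, hx, hy, by ring, h⟩
  have hd : j - i = -(i - j) := by ring
  have hasymm : x < y → ¬ y < x := fun h => h.asymm
  simp only [TRel, key hx hy, key hy hx]
  rw [hd]
  generalize i - j = d
  have hfin : ∀ k : ZMod 3, k = 0 ∨ k = 1 ∨ k = -1 := by decide
  rcases hfin k with rfl | rfl | rfl <;> rcases hfin d with rfl | rfl | rfl <;>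
  by_cases h1 : x < y <;> by_cases h2 : y < x <;>
  first
    | exact absurd h2 (hasymm h1)
    | (simp only [h1, h2]; decide)

/-- The edge relation of `P(3)` is asymmetric, so that `P(3)` is a directed graph. -/
theorem P3_asymm {P : Type u} [PartialOrder P] {D : ZMod 3 → Set P}
    (hD : ∀ x : P, ∃! i, x ∈ D i) {x y : P} (h : (P3 D).Adj x y) : ¬ (P3 D).Adj y x := by
  obtain ⟨i, hx, -⟩ := hD x
  obtain ⟨j, hy, -⟩ := hD y
  intro h'
  have e1 := (P3_spec hD hx hy (-1 - (j - i))).1 (Or.inl ⟨by ring, h⟩)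
  have e2 := (P3_spec hD hx hy (1 - (j - i))).1 (Or.inr (Or.inl ⟨by ring, h'⟩))
  have hasymm : x < y → ¬ y < x := fun h => h.asymm
  revert e1 e2
  simp only [TRel]
  generalize j - i = d
  revert d
  by_cases h1 : x < y <;> by_cases h2 : y < x
  · exact absurd h2 (hasymm h1)
  all_goals simp only [h1, h2]; decide

/-! ### The expansion of `P(3)` -/

/-- The relation symbols `E`, `R_0`, `R_1`, `R_2`, `<`. -/
inductive P3StarRel : ℕ → Type
  | edge : P3StarRel 2
  | part (i : ZMod 3) : P3StarRel 1
  | lt : P3StarRel 2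

/-- The relational signature `{E, R_0, R_1, R_2, <}`. -/
def P3StarLang : FirstOrder.Language.{0, 0} := ⟨fun _ => Empty, P3StarRel⟩

/-- The structure `P(3)*`: the digraph `P(3)`, expanded by the three parts `D i` and by a binary
relation `lt` (in the theorem a linear extension of the order of `P`). -/
def P3Star {P : Type u} [PartialOrder P] (D : ZMod 3 → Set P) (lt : P → P → Prop) :
    Bundled.{u} P3StarLang.Structure :=
  ⟨P, { funMap := fun f _ => nomatch f
        RelMap := fun {_} r =>
          match r with
          | .edge => fun v => (P3 D).Adj (v 0) (v 1)
          | .part i => fun v => v 0 ∈ D i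
          | .lt => fun v => lt (v 0) (v 1) }⟩

/-! Once the parts are named, `E` and `≺` determine each other: on a pair with labels `i`, `j` they
differ by the shift `j - i` of the index of `T`. So embeddings between finite substructures of
`P3Star` are embeddings of finite posets with a linear extension and labels in `ZMod 3`
(`P3Star_relMap_iff`), and the Ramsey property is needed for these.

Encode such a poset by its down-sets, listed colexicographically, with the empty set as number 0. A
parameter word with constant 0 and the nonempty down-sets as parameters embeds the poset in a
lexicographically ordered Boolean cube (`IsDownEnum.isEmb_wordMap`). An embedding of `A` in `B`
pulls down-sets back; this is again a parameter word, and composition becomes substitution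
(`IsEmb.exists_preimage_word`). Hence the Graham–Rothschild theorem (`grahamRothschild`) gives
`exists_ramsey`, with a cube as the large poset.

That poset must still be found in `P` with the given order `<`. Density realises its order and
labels, but leaves `<` uncontrolled. Applying Ramsey to incomparable pairs yields a larger poset in
which every linear extension induces the prescribed order on some copy (`exists_isEmb_agreeing`). -/

/-! ### Parameter words -/

/-- `RG a w b`: the word `w` has letters below `b`, and the letters `a, a + 1, …, b - 1` occur
in it for the first time in this order. Letters below `a` are constants, the others parameters. -/
inductive RG : ℕ → List ℕ → ℕ → Prop
  | nil (a : ℕ) : RG a [] a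
  | old {a x b : ℕ} {w : List ℕ} : x < a → RG a w b → RG a (x :: w) b
  | new {a b : ℕ} {w : List ℕ} : RG (a + 1) w b → RG a (a :: w) b

/-- The substitution that fixes letters below `a` and replaces `a + i` by the `i`-th letter
of `v`. -/
def subst (a : ℕ) (v : List ℕ) (x : ℕ) : ℕ := if x < a then x else v.getD (x - a) 0

theorem RG.append {a b c : ℕ} {u w : List ℕ} (hu : RG a u b) (hw : RG b w c) :
    RG a (u ++ w) c := by
  induction hu with
  | nil => exact hw
  | old h _ ih => exact .old h (ih hw)
  | new _ ih => exact .new (ih hw)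

theorem RG.of_forall_lt {a : ℕ} {u : List ℕ} (h : ∀ x ∈ u, x < a) : RG a u a := by
  induction u with
  | nil => exact .nil a
  | cons x u ih =>
    exact .old (h x (by simp)) (ih fun y hy => h y (by simp [hy]))

theorem RG.range' (a n : ℕ) : RG a (List.range' a n) (a + n) := by
  induction n generalizing a with
  | zero => exact .nil a
  | succ n ih =>
    rw [List.range'_succ]
    have := ih (a + 1)
    rw [show a + 1 + n = a + (n + 1) by ring] at this
    exact .new this

theorem RG.le {a b : ℕ} {w : List ℕ} (h : RG a w b) : a ≤ b := by
  induction h with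
  | nil => rfl
  | old _ _ ih => exact ih
  | new _ ih => omega

theorem RG.lt {a b : ℕ} {w : List ℕ} (h : RG a w b) : ∀ x ∈ w, x < b := by
  induction h with
  | nil => simp
  | old hx hw ih =>
    have := hw.le
    simp only [List.mem_cons, forall_eq_or_imp]
    exact ⟨by omega, ih⟩
  | new hw ih =>
    have := hw.le
    simp only [List.mem_cons, forall_eq_or_imp]
    exact ⟨by omega, ih⟩

theorem RG.mem_of_append_cons {a b j j' : ℕ} {w u t : List ℕ} (h : RG a w b)
    (hw : w = u ++ j' :: t) (hj : a ≤ j) (hjj' : j < j') : j ∈ u := by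
  induction h generalizing u with
  | nil => simp at hw
  | old hx _ ih =>
    cases u with
    | nil => simp at hw; omega
    | cons y u => simp at hw; exact List.mem_cons_of_mem _ (ih hw.2 hj)
  | @new a b w hw' ih =>
    cases u with
    | nil => simp at hw; omega
    | cons y u =>
      simp at hw
      rcases hj.eq_or_lt with rfl | hj
      · simp [hw.1]
      · exact List.mem_cons_of_mem _ (ih hw.2 hj)

theorem RG.mem_of_le_of_lt {a b j : ℕ} {w : List ℕ} (h : RG a w b) (hj : a ≤ j) (hb : j < b) :
    j ∈ w := by
  induction h with
  | nil => omega
  | old _ _ ih => exact List.mem_cons_of_mem _ (ih hj hb)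
  | new _ ih =>
    rcases hj.eq_or_lt with rfl | hj
    · simp
    · exact List.mem_cons_of_mem _ (ih hj hb)

theorem RG.of_occurrences {a b : ℕ} {w : List ℕ} (hab : a ≤ b) (hlt : ∀ x ∈ w, x < b)
    (hmem : ∀ j, a ≤ j → j < b → j ∈ w)
    (hord : ∀ u t j j', w = u ++ j' :: t → a ≤ j → j < j' → j ∈ u) : RG a w b := by
  induction w generalizing a with
  | nil =>
    rcases hab.eq_or_lt with rfl | h
    · exact .nil _
    · exact absurd (hmem a le_rfl h) (by simp)
  | cons x w ih =>
    have hxa : x ≤ a := by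
      by_contra! h
      exact absurd (hord [] w a x rfl le_rfl h) (by simp)
    have hxb := hlt x (by simp)
    rcases hxa.eq_or_lt with rfl | hxa
    · refine .new (ih hxb (fun y hy => hlt y (by simp [hy])) ?_ ?_)
      · intro j hj hb
        have := hmem j (by omega) hb
        rw [List.mem_cons] at this
        exact this.resolve_left (by omega)
      · rintro u t j j' rfl hj hjj'
        have := hord (x :: u) t j j' rfl (by omega) hjj'
        rw [List.mem_cons] at this
        exact this.resolve_left (by omega)
    · refine .old hxa (ih hab (fun y hy => hlt y (by simp [hy])) ?_ ?_)
      · intro j hj hb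
        have := hmem j (by omega) hb
        rw [List.mem_cons] at this
        exact this.resolve_left (by omega)
      · rintro u t j j' rfl hj hjj'
        have := hord (x :: u) t j j' rfl (by omega) hjj'
        rw [List.mem_cons] at this
        exact this.resolve_left (by omega)

/-- The parameters of `f` first occur in increasing order and repetitions bring no new letter, so
new letters appear in the image in the same order as in `σ p, …, σ (q - 1)`. -/
theorem RG.map {p q a c : ℕ} {f : List ℕ} {σ : ℕ → ℕ} (hf : RG p f q)
    (hσ : ∀ i < p, σ i < a) (hr : RG a ((List.range' p (q - p)).map σ) c) :
    RG a (f.map σ) c := by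
  induction hf generalizing a with
  | nil p => simpa using hr
  | old hx _ ih => exact .old (hσ _ hx) (ih hσ hr)
  | @new p q w hw ih =>
    have hle := hw.le
    obtain ⟨d, rfl⟩ := Nat.exists_eq_add_of_le hle
    rw [show p + 1 + d - p = d + 1 by omega, List.range'_succ, List.map_cons] at hr
    rw [List.map_cons]
    rw [Nat.add_sub_cancel_left] at ih
    generalize hy : σ p = y at hr
    cases hr with
    | old h hr =>
      refine .old h (ih (fun i hi => ?_) hr)
      rcases Nat.lt_succ_iff_lt_or_eq.1 hi with h' | rfl
      · exact hσ i h'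
      · omega
    | new hr =>
      refine .new (ih (fun i hi => ?_) hr)
      rcases Nat.lt_succ_iff_lt_or_eq.1 hi with h' | rfl
      · exact (hσ i h').trans (by omega)
      · omega

theorem RG.map_shift {p a n : ℕ} {f : List ℕ} {σ : ℕ → ℕ} (hf : RG p f (p + n))
    (hσ : ∀ i < p, σ i < a) (hr : ∀ i < n, σ (p + i) = a + i) :
    RG a (f.map σ) (a + n) := by
  refine hf.map hσ ?_
  have : (List.range' p (p + n - p)).map σ = List.range' a n := by
    apply List.ext_getElem <;> simp +contextual [hr]
  rw [this]
  exact RG.range' a n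

theorem subst_of_lt {a x : ℕ} (v : List ℕ) (h : x < a) : subst a v x = x := if_pos h

theorem subst_add (a i : ℕ) (v : List ℕ) : subst a v (a + i) = v.getD i 0 := by
  simp [subst]

theorem map_subst_range' (a : ℕ) (v : List ℕ) :
    (List.range' a v.length).map (subst a v) = v := by
  apply List.ext_getElem <;> simp +contextual [subst_add]

theorem map_subst_of_lt {a : ℕ} {w : List ℕ} (v : List ℕ) (h : ∀ x ∈ w, x < a) :
    w.map (subst a v) = w := by
  conv_rhs => rw [← List.map_id w]
  exact List.map_congr_left fun x hx => subst_of_lt v (h x hx)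

theorem RG.subst {a a' b c : ℕ} {f v : List ℕ} (hf : RG a f b) (haa' : a ≤ a') (hv : RG a' v c)
    (hl : a + v.length = b) : RG a' (f.map (subst a v)) c := by
  subst hl
  refine hf.map (fun i hi => by rw [subst_of_lt v hi]; omega) ?_
  rwa [Nat.add_sub_cancel_left, map_subst_range']

/-- Associativity of substitution. The bound on the letters of `f` keeps lookups in `g` away from
the default value. -/
theorem map_subst_map_subst {a : ℕ} {f g v : List ℕ} (hf : ∀ x ∈ f, x < a + g.length) :
    (f.map (subst a g)).map (subst a v) = f.map (subst a (g.map (subst a v))) := by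
  rw [List.map_map]
  refine List.map_congr_left fun x hx => ?_
  rcases lt_or_ge x a with h | h
  · simp [subst_of_lt, h]
  · obtain ⟨i, rfl⟩ := Nat.exists_eq_add_of_le h
    have : i < g.length := by have := hf _ hx; omega
    simp [subst_add, this]

/-! ### The Graham–Rothschild theorem -/

/-- The Graham–Rothschild property for `m` parameters. -/
def GrahamRothschild (m : ℕ) : Prop :=
  ∀ a : ℕ, 0 < a → ∀ (n : ℕ) (κ : Type) [Finite κ], ∃ N : ℕ, ∀ c : List ℕ → κ,
    ∃ f : List ℕ, f.length = N ∧ RG a f (a + n) ∧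
      ∃ k, ∀ v : List ℕ, v.length = n → RG a v (a + m) → c (f.map (subst a v)) = k

/-- The block of `n` letters at a coordinate of a line over the alphabet `Fin n → Fin a`. -/
def block (a n : ℕ) : Option (Fin n → Fin a) → List ℕ
  | none => List.range' a n
  | some x => List.ofFn fun i => (x i : ℕ)

theorem length_block {a n : ℕ} (o : Option (Fin n → Fin a)) : (block a n o).length = n := by
  cases o <;> simp [block]

theorem length_flatMap_block {a n : ℕ} (os : List (Option (Fin n → Fin a))) :
    (os.flatMap (block a n)).length = os.length * n := by
  induction os with
  | nil => simp
  | cons o os ih => simp [length_block, ih]; ring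

theorem lt_of_mem_block {a n : ℕ} {o : Option (Fin n → Fin a)} {x : ℕ} (hx : x ∈ block a n o) :
    x < a + n := by
  cases o with
  | none => simp [block] at hx; omega
  | some y =>
    simp [block, List.mem_ofFn] at hx
    obtain ⟨i, rfl⟩ := hx
    omega

theorem RG.flatMap_block {a n : ℕ} {os : List (Option (Fin n → Fin a))} (h : none ∈ os) :
    RG a (os.flatMap (block a n)) (a + n) := by
  induction os with
  | nil => simp at h
  | cons o os ih =>
    rw [List.flatMap_cons]
    cases o with
    | none =>
      refine (RG.range' a n).append (RG.of_forall_lt fun x hx => ?_)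
      obtain ⟨o, -, ho⟩ := List.mem_flatMap.1 hx
      exact lt_of_mem_block ho
    | some y =>
      refine RG.append (b := a) (RG.of_forall_lt fun x hx => ?_) (ih (by simpa using h))
      simp [block, List.mem_ofFn] at hx
      obtain ⟨i, rfl⟩ := hx
      omega

theorem map_subst_block {a n : ℕ} (o : Option (Fin n → Fin a)) (x : Fin n → Fin a) :
    (block a n o).map (subst a (List.ofFn fun i => (x i : ℕ))) = block a n (some (o.getD x)) := by
  cases o with
  | none =>
    have := map_subst_range' a (List.ofFn fun i => (x i : ℕ))
    rw [List.length_ofFn] at this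
    exact this
  | some y =>
    refine map_subst_of_lt _ fun z hz => ?_
    simp [block, List.mem_ofFn] at hz
    obtain ⟨i, rfl⟩ := hz
    omega

/-- Hales–Jewett over the alphabet of blocks of `n` constants: spelled out, a line carries all `n`
parameters at each moving coordinate, and its points are the instances of this word. -/
theorem grahamRothschild_zero : GrahamRothschild 0 := by
  intro a _ n κ _
  obtain ⟨ι, _, hι⟩ := Combinatorics.Line.exists_mono_in_high_dimension (Fin n → Fin a) κ
  let e := Fintype.equivFin ι
  refine ⟨Fintype.card ι * n, fun c => ?_⟩
  obtain ⟨l, k, hl⟩ := hι fun w =>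
    c ((List.ofFn fun i => some (w (e.symm i))).flatMap (block a n))
  refine ⟨(List.ofFn fun i => l.idxFun (e.symm i)).flatMap (block a n), ?_, ?_, k, ?_⟩
  · rw [length_flatMap_block, List.length_ofFn]
  · obtain ⟨i, hi⟩ := l.proper
    exact RG.flatMap_block ((List.mem_ofFn' _ _).2 ⟨e i, by simp [hi]⟩)
  · intro v hv hva
    have hlt := hva.lt
    let x : Fin n → Fin a := fun i => ⟨v[i], hlt _ (by simp)⟩
    have hvx : v = List.ofFn fun i => (x i : ℕ) := by
      apply List.ext_getElem <;> simp [hv, x]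
    rw [← hl x, hvx]
    congr 1
    rw [List.map_flatMap]
    simp_rw [map_subst_block]
    simp only [List.flatMap_def, List.map_ofFn]
    congr 2

/-! ### Reduction to the position of the first parameter -/

/-- The length of the longest prefix without parameters. -/
def headLength (a : ℕ) (v : List ℕ) : ℕ := (v.takeWhile (· < a)).length

theorem headLength_cons_of_lt {a x : ℕ} (v : List ℕ) (h : x < a) :
    headLength a (x :: v) = headLength a v + 1 := by simp [headLength, h]

theorem headLength_cons_self (a : ℕ) (v : List ℕ) : headLength a (a :: v) = 0 := by
  simp [headLength]

theorem RG.headLength_lt {a b : ℕ} {v : List ℕ} (h : RG a v b) (hab : a < b) :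
    headLength a v < v.length := by
  induction h with
  | nil => omega
  | old hx _ ih => rw [headLength_cons_of_lt _ hx]; simpa using ih hab
  | new => simp [headLength_cons_self]

/-- Renumbering of parameters that makes room for one more in front. -/
def bump (a x : ℕ) : ℕ := if x < a then x else x + 1

theorem subst_cons_bump (a x y : ℕ) (v : List ℕ) :
    subst a (y :: v) (bump a x) = subst a v x := by
  rcases lt_or_ge x a with h | h
  · simp [bump, h, subst_of_lt]
  · obtain ⟨i, rfl⟩ := Nat.exists_eq_add_of_le h
    simp [bump, subst_add, add_assoc]

theorem RG.map_bump {a n : ℕ} {f : List ℕ} (hf : RG a f (a + n)) :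
    RG (a + 1) (f.map (bump a)) (a + 1 + n) :=
  hf.map_shift (fun i hi => by simp [bump, hi]; omega) fun i _ => by simp [bump]; omega

/-- Pigeonhole: some subspace meets only one colour class of positions. -/
theorem exists_headLength_mono {κ : Type*} {a : ℕ} (ha : 0 < a) (k : κ) (n : ℕ) (L : List κ)
    [DecidableEq κ] (h : n ≤ L.count k) :
    ∃ g : List ℕ, g.length = L.length ∧ RG a g (a + n) ∧ ∀ (m : ℕ) (v : List ℕ), v.length = n →
      RG a v (a + (m + 1)) → L[headLength a (g.map (subst a v))]? = some k := by
  induction L generalizing n with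
  | nil =>
    obtain rfl : n = 0 := by simpa using h
    refine ⟨[], rfl, .nil a, fun m v hv h => ?_⟩
    obtain rfl := List.length_eq_zero_iff.1 hv
    have := h.headLength_lt (by omega)
    simp at this
  | cons k' L ih =>
    by_cases hk : k' = k
    · subst hk
      cases n with
      | zero =>
        refine ⟨List.replicate (L.length + 1) 0, by simp, RG.of_forall_lt ?_, ?_⟩
        · intro x hx
          rw [List.eq_of_mem_replicate hx]; exact ha
        · intro m v hv h
          obtain rfl := List.length_eq_zero_iff.1 hv
          have := h.headLength_lt (by omega)
          simp at this
      | succ n =>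
        obtain ⟨g, hg, hrg, hm⟩ := ih n (by simpa using h)
        -- A position of colour `k` becomes a parameter. If a constant is substituted for it, the
        -- first parameter comes later and induction applies.
        refine ⟨a :: g.map (bump a), by simp [hg], .new ?_, ?_⟩
        · have := hrg.map_bump
          rwa [show a + 1 + n = a + (n + 1) by ring] at this
        · intro m v hv hrv
          cases hrv with
          | @old _ x _ w hx hw =>
            have e : (g.map (bump a)).map (subst a (x :: w)) = g.map (subst a w) := by
              simp [subst_cons_bump]
            have e0 : subst a (x :: w) a = x := by simpa using subst_add a 0 (x :: w)
            rw [List.map_cons, e, e0, headLength_cons_of_lt _ hx]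
            simpa using hm m w (by simpa using hv) hw
          | @new _ _ w hw =>
            have e0 : subst a (a :: w) a = a := by simpa using subst_add a 0 (a :: w)
            rw [List.map_cons, e0, headLength_cons_self]
            rfl
    · obtain ⟨g, hg, hrg, hm⟩ := ih n (by simpa [List.count_cons, hk] using h)
      -- The constant 0 keeps the first parameter away from a position of another colour.
      refine ⟨0 :: g, by simp [hg], .old ha hrg, fun m v hv hrv => ?_⟩
      rw [List.map_cons, subst_of_lt v ha, headLength_cons_of_lt _ ha]
      simpa using hm m v hv hrv

theorem exists_le_count (κ : Type*) [Finite κ] [DecidableEq κ] (n : ℕ) :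
    ∃ N : ℕ, ∀ L : List κ, L.length = N → ∃ k, n ≤ L.count k := by
  cases nonempty_fintype κ
  refine ⟨Fintype.card κ * n + 1, fun L hL => ?_⟩
  by_contra! hlt
  have h1 : ∑ k, L.count k ≤ ∑ _k : κ, n := Finset.sum_le_sum fun k _ => (hlt k).le
  have h2 : ∑ k, L.count k = L.length := by
    have := Multiset.sum_count_eq_card (s := Finset.univ) (m := (L : Multiset κ))
      (fun a _ => Finset.mem_univ a)
    simpa using this
  simp at h1
  omega

/-- Induction on `n`, with a one-parameter prefix `l` of length `L` and a tail that may copy letters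
of the prefix. If `v` starts with a parameter, `hm` applies: with `a + i` denoting the `i`-th letter
of the prefix, the tail has only `m` parameters over `a + L` constants. If `v` starts with a
constant, the inductive hypothesis handles the rest of `v`, and a Hales–Jewett line makes the colour
independent of that constant. -/
theorem exists_headLength_determined {m : ℕ} (hm : GrahamRothschild m) {a : ℕ} (ha : 0 < a)
    (n : ℕ) (κ : Type) [Finite κ] : ∃ N : ℕ, ∀ c : List ℕ → κ,
      ∃ f : List ℕ, f.length = N ∧ RG a f (a + n) ∧ ∃ χ : ℕ → κ, ∀ v : List ℕ, v.length = n →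
        RG a v (a + (m + 1)) → c (f.map (subst a v)) = χ (headLength a v) := by
  induction n generalizing κ with
  | zero =>
    refine ⟨0, fun c => ⟨[], rfl, .nil a, fun _ => c [], fun v hv h => ?_⟩⟩
    obtain rfl := List.length_eq_zero_iff.1 hv
    have := h.headLength_lt (by omega)
    simp at this
  | succ n ih =>
    -- Colours are functions, so that all head lengths, respectively all prefixes, are treated at
    -- once.
    obtain ⟨L, hL⟩ := grahamRothschild_zero a ha 1 (Fin n → κ)
    obtain ⟨N₁, hN₁⟩ := ih ((Fin L → Fin a) → κ)
    obtain ⟨N₀, hN₀⟩ := hm (a + L) (by omega) N₁ ((Fin L → Fin (a + 1)) → κ)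
    refine ⟨L + N₀, fun c => ?_⟩
    -- Parameters of the tail, from `a + L` on, become `a + 1, …`, since `a` is reserved for the
    -- parameter in the prefix.
    obtain ⟨f₀, hf₀, hrf₀, k₀, hk₀⟩ := hN₀ fun y l =>
      c (List.ofFn (fun i => (l i : ℕ)) ++ y.map fun x =>
        if x < a + L then subst a (List.ofFn fun i => (l i : ℕ)) x else x - L + 1)
    obtain ⟨f₁, hf₁, hrf₁, χ, hχ⟩ := hN₁ fun v w =>
      c (List.ofFn (fun i => (w i : ℕ)) ++ f₀.map (subst a (List.ofFn (fun i => (w i : ℕ)) ++ v)))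
    have toFin : ∀ (b : ℕ) (l : List ℕ), l.length = L → (∀ x ∈ l, x < b) →
        ∃ w : Fin L → Fin b, List.ofFn (fun i => (w i : ℕ)) = l := fun b l hl hlt =>
      ⟨fun i => ⟨l[i], hlt _ (by simp)⟩, by apply List.ext_getElem <;> simp [hl]⟩
    obtain ⟨l, hl, hrl, k, hk⟩ := hL fun w i =>
      if h : ∃ w' : Fin L → Fin a, List.ofFn (fun i => (w' i : ℕ)) = w then χ i h.choose
      else c []
    have hltl := hrl.lt
    refine ⟨l ++ f₀.map (subst a (l ++ f₁.map (bump a))), by simp [hl, hf₀],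
      hrl.append ?_, ?_⟩
    · refine hrf₀.map (fun i hi => ?_) ?_
      · rcases lt_or_ge i a with h | h
        · rw [subst_of_lt _ h]; omega
        · obtain ⟨j, rfl⟩ := Nat.exists_eq_add_of_le h
          have hj : j < l.length := by omega
          simpa [subst_add, List.getElem?_append_left hj, hj] using hltl _ (List.getElem_mem hj)
      · have : (List.range' (a + L) (a + L + N₁ - (a + L))).map
            (subst a (l ++ f₁.map (bump a))) = f₁.map (bump a) := by
          apply List.ext_getElem <;> simp +contextual [hf₁, add_assoc, subst_add, hl, ← Nat.sub_sub]
        rw [this, show a + (n + 1) = a + 1 + n by ring]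
        exact hrf₁.map_bump
    · have key : ∀ x v', (l ++ f₀.map (subst a (l ++ f₁.map (bump a)))).map (subst a (x :: v')) =
          l.map (subst a [x]) ++ f₀.map (subst a (l.map (subst a [x]) ++ f₁.map (subst a v'))) := by
        intro x v'
        have e1 : l.map (subst a (x :: v')) = l.map (subst a [x]) := by
          refine List.map_congr_left fun y hy => ?_
          have hy := hltl y hy
          rcases lt_or_ge y a with h | h
          · simp [subst_of_lt, h]
          · obtain rfl : y = a := by omega
            simp [subst]
        rw [List.map_append, map_subst_map_subst, List.map_append, e1]
        · congr 4
          simp [Function.comp_def, subst_cons_bump]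
        · intro y hy
          have := hrf₀.lt y hy
          simp [hl, hf₁]; omega
      refine ⟨fun j => match j with
        | 0 => k₀ fun i => ⟨l[i], hltl _ (by simp)⟩
        | j + 1 => if h : j < n then k ⟨j, h⟩ else c [], fun v hv hrv => ?_⟩
      cases hrv with
      | @old _ x _ v' hx hv' =>
        have hlen : v'.length = n := by simpa using hv
        have hj : headLength a v' < n := hlen ▸ hv'.headLength_lt (by omega)
        obtain ⟨w, hw⟩ := toFin a (l.map (subst a [x])) (by simp [hl]) (by
          intro y hy
          obtain ⟨z, hz, rfl⟩ := List.mem_map.1 hy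
          have hz := hltl z hz
          rcases lt_or_ge z a with h | h
          · simp [subst_of_lt, h]
          · obtain rfl : z = a := by omega
            simpa [subst])
        have h1 := congrFun (hχ v' hlen hv') w
        have h2 := congrFun (hk [x] rfl (.old hx (.nil a))) ⟨_, hj⟩
        have hex : ∃ w' : Fin L → Fin a, List.ofFn (fun i => (w' i : ℕ)) =
          l.map (subst a [x]) := ⟨w, hw⟩
        have hww : hex.choose = w := by
          have h3 := hex.choose_spec.trans hw.symm
          have := List.ofFn_injective h3
          funext i
          exact Fin.ext (congrFun this i)
        simp only [dif_pos hex, hww] at h2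
        rw [key, headLength_cons_of_lt _ hx]
        simp only [hj, dite_true]
        rw [← h2, ← h1, hw]
      | @new _ _ v' hv' =>
        have hlen : v'.length = n := by simpa using hv
        have hmem : a ∈ l := hrl.mem_of_le_of_lt le_rfl (by omega)
        obtain ⟨p, hp, hpa⟩ := List.getElem_of_mem hmem
        have hla : l.map (subst a [a]) = l := by
          conv_rhs => rw [← List.map_id l]
          refine List.map_congr_left fun y hy => ?_
          have hy := hltl y hy
          rcases lt_or_ge y a with h | h
          · simp [subst_of_lt, h]
          · obtain rfl : y = a := by omega
            simp [subst]
        rw [key, hla, headLength_cons_self]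
        set u := f₁.map (subst a v') with hu
        have hru : RG (a + 1) u (a + 1 + m) := by
          refine hrf₁.subst (by omega) ?_ (by omega)
          rwa [show a + (m + 1) = a + 1 + m by ring] at hv'
        -- The parameter `a` stands at position `p` of `l`, so the tail can write it as the constant
        -- `a + p`; later parameters are shifted to start at `a + L`.
        let θ : ℕ → ℕ := fun x => if x < a then x else if x = a then a + p else x - 1 + L
        have hθ : RG (a + L) (u.map θ) (a + L + m) := by
          refine hru.map_shift (fun i hi => ?_) fun i _ => ?_
          · simp only [θ]; split_ifs <;> omega
          · simp only [θ]
            rw [if_neg (by omega), if_neg (by omega)]; omega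
        have h := congrFun (hk₀ (u.map θ) (by simp [hu, hf₁]) hθ)
          fun i => ⟨l[i], hltl _ (by simp)⟩
        have hofn : (List.ofFn fun i : Fin L => l[(i : ℕ)]) = l := by
          apply List.ext_getElem <;> simp [hl]
        simp only [Fin.getElem_fin] at h ⊢
        rw [← h, hofn, List.map_map]
        congr 2
        refine List.map_congr_left fun z hz => ?_
        have hz := hrf₀.lt z hz
        rcases lt_or_ge z a with h | h
        · simp [subst_of_lt, h, show z < a + L by omega]
        · obtain ⟨i, rfl⟩ := Nat.exists_eq_add_of_le h
          rcases lt_or_ge i L with h' | h'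
          · have : subst (a + L) (u.map θ) (a + i) = a + i := subst_of_lt _ (by omega)
            simp [this, subst_add, h', hl, List.getElem?_append_left (hl ▸ h')]
          · obtain ⟨j, rfl⟩ := Nat.exists_eq_add_of_le h'
            have hj : j < u.length := by simp [hu, hf₁]; omega
            have huj : u[j] < a + 1 + m := hru.lt _ (List.getElem_mem hj)
            rw [← add_assoc, Function.comp_apply, subst_add, add_assoc, subst_add]
            simp only [List.getD_eq_getElem?_getD, List.getElem?_map, hj,
              List.getElem?_eq_getElem, Option.map_some, Option.getD_some, θ]
            rw [List.getElem?_append_right (by omega), hl, Nat.add_sub_cancel_left,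
              List.getElem?_eq_getElem hj, Option.getD_some]
            generalize u[j] = y
            rcases lt_trichotomy y a with h1 | rfl | h1
            · simp [h1, subst_of_lt, show y < a + L by omega]
            · simp [subst_add, hp, hpa, ← hl]
            · simp [show ¬ y < a by omega, show y ≠ a by omega, show ¬ y - 1 + L < a + L by omega]
              omega

/-- For `m + 1`, first make the colour depend only on the head length. Among enough head lengths
some colour occurs `n` times, and `g` puts its parameters at such positions. -/
theorem grahamRothschild (m : ℕ) : GrahamRothschild m := by
  induction m with
  | zero => exact grahamRothschild_zero
  | succ m ih =>
    classical
    intro a ha n κ _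
    obtain ⟨n', hn'⟩ := exists_le_count κ n
    obtain ⟨N, hN⟩ := exists_headLength_determined ih ha n' κ
    refine ⟨N, fun c => ?_⟩
    obtain ⟨f, hf, hrf, χ, hχ⟩ := hN c
    obtain ⟨k, hk⟩ := hn' ((List.range n').map χ) (by simp)
    obtain ⟨g, hg, hrg, hgk⟩ := exists_headLength_mono ha k n _ hk
    rw [List.length_map, List.length_range] at hg
    refine ⟨f.map (subst a g), by simp [hf], hrf.subst le_rfl hrg (by omega), k,
      fun v hv hrv => ?_⟩
    have hr : RG a (g.map (subst a v)) (a + (m + 1)) := hrg.subst le_rfl hrv (by omega)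
    have hlt := hr.headLength_lt (by omega)
    rw [map_subst_map_subst (fun x hx => by have := hrf.lt x hx; omega),
      hχ _ (by simp [hg]) hr]
    have := hgk m v hv hrv
    rw [List.length_map, hg] at hlt
    simpa [List.getElem?_map, List.getElem?_range, hlt] using this

/-! ### Finite partial orders with a linear extension and labels -/

/-- A labelled partial order (given by its strict order `r`) with a linear extension `lt`. -/
structure OrderedLabelledPoset (X : Type*) where
  lt : X → X → Prop
  r : X → X → Prop
  lab : X → ZMod 3
  isStrictTotalOrder : IsStrictTotalOrder X lt
  r_trans : ∀ {x y z}, r x y → r y z → r x z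
  r_lt : ∀ {x y}, r x y → lt x y

namespace OrderedLabelledPoset

variable {X Y Z : Type*} {A : OrderedLabelledPoset X} {B : OrderedLabelledPoset Y}
  {C : OrderedLabelledPoset Z}

theorem lt_irrefl (A : OrderedLabelledPoset X) (x : X) : ¬ A.lt x x :=
  haveI := A.isStrictTotalOrder
  irrefl x

theorem lt_trans (A : OrderedLabelledPoset X) {x y z : X} (h : A.lt x y) (h' : A.lt y z) :
    A.lt x z :=
  haveI := A.isStrictTotalOrder
  _root_.trans h h'

theorem lt_trichotomy (A : OrderedLabelledPoset X) (x y : X) : A.lt x y ∨ x = y ∨ A.lt y x :=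
  haveI := A.isStrictTotalOrder
  trichotomous x y

/-- Embeddings of ordered labelled posets. -/
structure IsEmb (A : OrderedLabelledPoset X) (B : OrderedLabelledPoset Y) (f : X → Y) : Prop where
  lt : ∀ {x y}, A.lt x y → B.lt (f x) (f y)
  r_iff : ∀ {x y}, B.r (f x) (f y) ↔ A.r x y
  lab : ∀ x, B.lab (f x) = A.lab x

theorem IsEmb.injective {f : X → Y} (hf : IsEmb A B f) : Function.Injective f := by
  intro x y h
  rcases A.lt_trichotomy x y with h' | h' | h'
  · exact absurd (h ▸ hf.lt h') (B.lt_irrefl _)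
  · exact h'
  · exact absurd (h ▸ hf.lt h') (B.lt_irrefl _)

theorem IsEmb.lt_iff {f : X → Y} (hf : IsEmb A B f) {x y : X} :
    B.lt (f x) (f y) ↔ A.lt x y := by
  refine ⟨fun h => ?_, hf.lt⟩
  rcases A.lt_trichotomy x y with h' | rfl | h'
  · exact h'
  · exact absurd h (B.lt_irrefl _)
  · exact absurd (B.lt_trans h (hf.lt h')) (B.lt_irrefl _)

theorem IsEmb.comp {f : X → Y} {g : Y → Z} (hg : IsEmb B C g) (hf : IsEmb A B f) :
    IsEmb A C (g ∘ f) :=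
  ⟨fun h => hg.lt (hf.lt h), hg.r_iff.trans hf.r_iff, fun x => (hg.lab _).trans (hf.lab x)⟩

/-- The structure induced along an injective map. -/
def comap (f : X → Y) (hf : Function.Injective f) (B : OrderedLabelledPoset Y) :
    OrderedLabelledPoset X where
  lt x y := B.lt (f x) (f y)
  r x y := B.r (f x) (f y)
  lab x := B.lab (f x)
  isStrictTotalOrder :=
    haveI := B.isStrictTotalOrder
    (RelEmbedding.preimage ⟨f, hf⟩ B.lt).isStrictTotalOrder
  r_trans h h' := B.r_trans h h'
  r_lt h := B.r_lt h

/-! ### Down-sets in colexicographic order -/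

/-- The down-sets of a labelled poset. -/
def IsDown (A : OrderedLabelledPoset X) (S : Set X) : Prop := ∀ x y, A.r x y → y ∈ S → x ∈ S

/-- Enumeration of the down-sets in the colexicographic order of the linear extension. -/
structure IsDownEnum (A : OrderedLabelledPoset X) (m : ℕ) (S : ℕ → Set X) : Prop where
  isDown : ∀ i ≤ m, A.IsDown (S i)
  exists_eq : ∀ T, A.IsDown T → ∃ i ≤ m, S i = T
  le_iff : ∀ i ≤ m, ∀ j ≤ m,
    (i ≤ j ↔ ∀ x ∈ S i, x ∉ S j → ∃ y ∈ S j, y ∉ S i ∧ A.lt x y)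

theorem exists_isDownEnum [Finite X] (A : OrderedLabelledPoset X) : ∃ m S, A.IsDownEnum m S := by
  classical
  cases nonempty_fintype X
  have := A.isStrictTotalOrder
  let _ : LinearOrder X := linearOrderOfSTO A.lt
  let _ : Fintype (Colex (Finset X)) := Fintype.ofEquiv _ toColex
  let s : Finset (Colex (Finset X)) :=
    Finset.univ.filter fun T => A.IsDown ((ofColex T : Finset X) : Set X)
  have h0 : toColex ∅ ∈ s := by simp [s, IsDown]
  obtain ⟨m, hm⟩ := Nat.exists_eq_add_of_le (Finset.card_pos.2 ⟨_, h0⟩)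
  have hm' : s.card = m + 1 := by rw [hm]; ring
  let o := s.orderIsoOfFin hm'
  let S : ℕ → Set X := fun i =>
    if h : i ≤ m then ((ofColex (o ⟨i, by omega⟩ : Colex (Finset X)) : Finset X) : Set X) else ∅
  refine ⟨m, S, fun i hi => ?_, fun T hT => ?_, fun i hi j hj => ?_⟩
  · simp only [S, dif_pos hi]
    exact (Finset.mem_filter.1 (o ⟨i, by omega⟩).2).2
  · have hmem : toColex T.toFinset ∈ s := by simpa [s] using hT
    have hlt := (o.symm ⟨_, hmem⟩).2
    refine ⟨o.symm ⟨_, hmem⟩, by omega, ?_⟩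
    simp only [S]
    rw [dif_pos (by omega)]
    simp
  · simp only [S, dif_pos hi, dif_pos hj]
    have : i ≤ j ↔ o ⟨i, by omega⟩ ≤ o ⟨j, by omega⟩ := by simp
    rw [this, ← Subtype.coe_le_coe, Finset.Colex.le_def]
    refine forall_congr' fun x => forall_congr' fun hx => forall_congr' fun _ => ?_
    refine exists_congr fun y => and_congr Iff.rfl (and_congr_right fun hy => ?_)
    refine Iff.trans ?_ (Iff.rfl : x < y ↔ A.lt x y)
    refine ⟨fun h => h.lt_of_ne ?_, le_of_lt⟩
    rintro rfl
    exact hy hx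

/-- The empty set is colexicographically least, so letter 0 can serve as the only constant. -/
theorem IsDownEnum.zero {m : ℕ} {S : ℕ → Set X} (h : A.IsDownEnum m S) : S 0 = ∅ := by
  obtain ⟨i, hi, hS⟩ := h.exists_eq ∅ (by simp [IsDown])
  have := (h.le_iff i hi 0 (by omega)).2 (by simp [hS])
  obtain rfl : i = 0 := by omega
  exact hS

theorem IsDownEnum.inj {m : ℕ} {S : ℕ → Set X} (h : A.IsDownEnum m S) {i j : ℕ} (hi : i ≤ m)
    (hj : j ≤ m) (hij : S i = S j) : i = j :=
  le_antisymm ((h.le_iff i hi j hj).2 fun _ hx hx' => absurd (hij ▸ hx) hx')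
    ((h.le_iff j hj i hi).2 fun _ hx hx' => absurd (hij ▸ hx) hx')

theorem IsDownEnum.exists_pos {m : ℕ} {S : ℕ → Set X} (h : A.IsDownEnum m S) {T : Set X}
    (hT : A.IsDown T) {x : X} (hx : x ∈ T) : ∃ i, 1 ≤ i ∧ i ≤ m ∧ S i = T := by
  obtain ⟨i, hi, rfl⟩ := h.exists_eq T hT
  refine ⟨i, Nat.one_le_iff_ne_zero.2 ?_, hi, rfl⟩
  rintro rfl
  rw [h.zero] at hx
  exact hx

/-! ### Parameter words as embeddings into the Boolean cube -/

/-- The linear order of `cube N` is pulled back along this map. -/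
def cubeKey (N : ℕ) (x : (Fin N → Bool) × ZMod 3) : Lex (Lex (Fin N → Bool) × ℕ) :=
  toLex (toLex x.1, x.2.val)

theorem cubeKey_injective (N : ℕ) : Function.Injective (cubeKey N) := by
  rintro ⟨x, i⟩ ⟨y, j⟩ h
  have h := Prod.ext_iff.1 (toLex_inj.1 h)
  exact Prod.ext (toLex_inj.1 h.1) (ZMod.val_injective 3 h.2)

/-- The lexicographically ordered Boolean cube, with three copies of each point. -/
def cube (N : ℕ) : OrderedLabelledPoset ((Fin N → Bool) × ZMod 3) where
  lt x y := cubeKey N x < cubeKey N y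
  r x y := x.1 < y.1
  lab x := x.2
  isStrictTotalOrder :=
    (RelEmbedding.preimage ⟨cubeKey N, cubeKey_injective N⟩ (· < ·)).isStrictTotalOrder
  r_trans h h' := _root_.lt_trans h h'
  r_lt h := Prod.Lex.toLex_lt_toLex.2 (Or.inl (Pi.toLex_strictMono h))

open Classical in
/-- The map to the cube that is given by a word whose letters are down-sets. -/
noncomputable def wordMap (A : OrderedLabelledPoset X) (S : ℕ → Set X) (N : ℕ) (w : List ℕ)
    (x : X) : (Fin N → Bool) × ZMod 3 :=
  (fun i => decide (x ∉ S (w.getD i 0)), A.lab x)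

/-- Every nonempty down-set occurs in `w`, so the coordinates recover `r`. For `x` before `y`, the
first coordinate separating them has `x` in its down-set: otherwise that set comes
colexicographically after the initial segment ending at `x`, which also separates them and so occurs
earlier in `w`. -/
theorem IsDownEnum.isEmb_wordMap {m : ℕ} {S : ℕ → Set X} (h : A.IsDownEnum m S) {w : List ℕ}
    (hw : RG 1 w (1 + m)) : IsEmb A (cube w.length) (A.wordMap S w.length w) := by
  classical
  have hle : ∀ i (hi : i < w.length), w[i] ≤ m := fun i hi => by
    have := hw.lt _ (List.getElem_mem hi); omega
  refine ⟨fun {x y} hxy => ?_, fun {x y} => ?_, fun x => rfl⟩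
  · have hT : A.IsDown {z | z = x ∨ A.lt z x} := by
      rintro a b hab (rfl | hb)
      · exact Or.inr (A.r_lt hab)
      · exact Or.inr (A.lt_trans (A.r_lt hab) hb)
    obtain ⟨t, ht1, htm, ht⟩ := h.exists_pos hT (Or.inl rfl)
    have hxt : x ∈ S t := ht ▸ Or.inl rfl
    have hyt : y ∉ S t := by
      rw [ht]
      rintro (rfl | hyx)
      · exact A.lt_irrefl _ hxy
      · exact A.lt_irrefl _ (A.lt_trans hxy hyx)
    obtain ⟨p, hp, hpt⟩ := List.getElem_of_mem (hw.mem_of_le_of_lt ht1 (by omega))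
    have hex : ∃ i, ∃ hi : i < w.length, ¬ (x ∈ S w[i] ↔ y ∈ S w[i]) :=
      ⟨p, hp, by simp [hpt, hxt, hyt]⟩
    obtain ⟨hi, hne⟩ := Nat.find_spec hex
    have hmin := fun {j} => Nat.find_min (m := j) hex
    set i := Nat.find hex
    refine Prod.Lex.toLex_lt_toLex.2 (Or.inl ⟨⟨i, hi⟩, fun j hj => ?_, ?_⟩)
    · have := hmin (Fin.lt_def.1 hj)
      simp only [not_exists, not_not] at this
      simpa [wordMap] using this j.2
    · by_cases hx : x ∈ S w[i]
      · have hy : y ∉ S w[i] := by tauto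
        simp [wordMap, hx, hy]
      · have hy : y ∈ S w[i] := by tauto
        exfalso
        have hti : t < w[i] := by
          refine lt_of_le_of_ne ((h.le_iff t htm _ (hle i hi)).2 ?_) ?_
          · intro a ha _
            refine ⟨y, hy, hyt, ?_⟩
            rw [ht] at ha
            rcases ha with rfl | ha
            · exact hxy
            · exact A.lt_trans ha hxy
          · intro e
            exact hx (e ▸ hxt)
        have hmem := hw.mem_of_append_cons (u := w.take i) (t := w.drop (i + 1))
          (by simp) ht1 hti
        obtain ⟨j, hj, hjt⟩ := List.getElem_of_mem hmem
        rw [List.length_take] at hj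
        rw [List.getElem_take] at hjt
        exact hmin (j := j) (by omega) ⟨by omega, by simp [hjt, hxt, hyt]⟩
  · have hlt : (cube w.length).r (A.wordMap S w.length w x) (A.wordMap S w.length w y) ↔
        (∀ i (hi : i < w.length), y ∈ S w[i] → x ∈ S w[i]) ∧
        ∃ i, ∃ hi : i < w.length, x ∈ S w[i] ∧ y ∉ S w[i] := by
      simp only [cube, wordMap, Pi.lt_def, Pi.le_def]
      refine and_congr ?_ ?_
      · simp [Fin.forall_iff, Bool.le_iff_imp]
        refine forall_congr' fun i => forall_congr' fun hi => ?_
        tauto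
      · simp [Fin.exists_iff, Bool.lt_iff]
    rw [hlt]
    have hT : A.IsDown {z | z = y ∨ A.r z y} := by
      rintro a b hab (rfl | hb)
      · exact Or.inr hab
      · exact Or.inr (A.r_trans hab hb)
    constructor
    · rintro ⟨hall, i, hi, hx, hy⟩
      obtain ⟨t, ht1, htm, ht⟩ := h.exists_pos hT (Or.inl rfl)
      obtain ⟨p, hp, hpt⟩ := List.getElem_of_mem (hw.mem_of_le_of_lt ht1 (by omega))
      have := hall p hp
      rw [hpt, ht] at this
      rcases this (Or.inl rfl) with rfl | h'
      · contradiction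
      · exact h'
    · intro hxy
      refine ⟨fun i hi hy => h.isDown _ (hle i hi) _ _ hxy hy, ?_⟩
      have hT : A.IsDown {z | z = x ∨ A.r z x} := by
        rintro a b hab (rfl | hb)
        · exact Or.inr hab
        · exact Or.inr (A.r_trans hab hb)
      obtain ⟨t, ht1, htm, ht⟩ := h.exists_pos hT (Or.inl rfl)
      obtain ⟨p, hp, hpt⟩ := List.getElem_of_mem (hw.mem_of_le_of_lt ht1 (by omega))
      refine ⟨p, hp, ?_⟩
      rw [hpt, ht]
      refine ⟨Or.inl rfl, ?_⟩
      rintro (rfl | h')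
      · exact A.lt_irrefl _ (A.r_lt hxy)
      · exact A.lt_irrefl _ (A.lt_trans (A.r_lt hxy) (A.r_lt h'))

/-- The preimages of down-sets under an embedding form a parameter word. -/
theorem IsEmb.exists_preimage_word {m n : ℕ} {S : ℕ → Set X} {T : ℕ → Set Y} {h : X → Y}
    (hh : IsEmb A B h) (hS : A.IsDownEnum m S) (hT : B.IsDownEnum n T) :
    ∃ v : List ℕ, v.length = n ∧ RG 1 v (1 + m) ∧
      ∀ i ≤ n, S (subst 1 v i) = h ⁻¹' T i := by
  have hdown : ∀ i, ∃ j, i ≤ n → j ≤ m ∧ S j = h ⁻¹' T i := by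
    intro i
    by_cases hi : i ≤ n
    · obtain ⟨j, hj⟩ := hS.exists_eq (h ⁻¹' T i) fun x y hxy hy =>
        hT.isDown i hi _ _ (hh.r_iff.2 hxy) hy
      exact ⟨j, fun _ => hj⟩
    · exact ⟨0, fun h => absurd h hi⟩
  choose σ hσ using hdown
  -- `S j` is the preimage of the down-set generated by its image. The index of the latter precedes
  -- every position with a letter above `j`.
  have hup : ∀ j, 1 ≤ j → j ≤ m → ∃ i, 1 ≤ i ∧ i ≤ n ∧
      T i = {y | ∃ x ∈ S j, y = h x ∨ B.r y (h x)} := by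
    intro j hj1 hjm
    have hne : (S j).Nonempty := by
      rw [Set.nonempty_iff_ne_empty, ← hS.zero]
      intro e
      have := hS.inj hjm (by omega) e
      omega
    obtain ⟨x, hx⟩ := hne
    refine hT.exists_pos ?_ (x := h x) ⟨x, hx, Or.inl rfl⟩
    rintro a b hab ⟨x, hx, rfl | hb⟩
    · exact ⟨x, hx, Or.inr hab⟩
    · exact ⟨x, hx, Or.inr (B.r_trans hab hb)⟩
  have hpre : ∀ i j, j ≤ m → T i = {y | ∃ x ∈ S j, y = h x ∨ B.r y (h x)} →
      h ⁻¹' T i = S j := by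
    intro i j hj e
    ext z
    rw [e]
    constructor
    · rintro ⟨x, hx, hz | hz⟩
      · rwa [hh.injective hz]
      · exact hS.isDown j hj _ _ (hh.r_iff.1 hz) hx
    · exact fun hz => ⟨z, hz, Or.inl rfl⟩
  have hσup : ∀ i j, i ≤ n → j ≤ m → T i = {y | ∃ x ∈ S j, y = h x ∨ B.r y (h x)} →
      σ i = j := fun i j hi hj e =>
    hS.inj (hσ i hi).1 hj ((hσ i hi).2.trans (hpre i j hj e))
  refine ⟨(List.range' 1 n).map σ, by simp, RG.of_occurrences (by omega) ?_ ?_ ?_, ?_⟩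
  · intro x hx
    obtain ⟨i, hi, rfl⟩ := List.mem_map.1 hx
    have := (hσ i (by simp at hi; omega)).1
    omega
  · intro j hj1 hjm
    obtain ⟨i, hi1, hin, hi⟩ := hup j hj1 (by omega)
    refine List.mem_map.2 ⟨i, ?_, hσup i j hin (by omega) hi⟩
    simp; omega
  · intro u t j j' hw hj1 hjj'
    have hlen := congrArg List.length hw
    simp at hlen
    have hj' : σ (u.length + 1) = j' := by
      have := congrArg (fun l => l[u.length]?) hw
      simp [show u.length < n by omega] at this
      rw [← this, add_comm]
    obtain ⟨hj'm, hSj'⟩ := hσ (u.length + 1) (by omega)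
    rw [hj'] at hj'm hSj'
    obtain ⟨i, hi1, hin, hi⟩ := hup j hj1 (by omega)
    have hσi := hσup i j hin (by omega) hi
    -- A point of `T i` outside the other set is at most some `h x`, with `x` in `S j` but not in `S
    -- j'`. Colexicographic order gives a later `y` in `S j'` outside `S j`, and `h y` is the
    -- required witness.
    have hile : i ≤ u.length + 1 := by
      refine (hT.le_iff i hin _ (by omega)).2 fun a ha ha' => ?_
      rw [hi] at ha
      obtain ⟨x, hx, hax⟩ := ha
      have hx' : h x ∉ T (u.length + 1) := by
        rcases hax with rfl | hax
        · exact ha'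
        · exact fun hx' => ha' (hT.isDown _ (by omega) _ _ hax hx')
      obtain ⟨y, hy, hyj, hxy⟩ := (hS.le_iff j (by omega) j' hj'm).1 hjj'.le x hx (by
        rw [hSj']; exact hx')
      refine ⟨h y, by rw [hSj'] at hy; exact hy, fun hy' => hyj ?_, ?_⟩
      · rw [← hpre i j (by omega) hi]; exact hy'
      · rcases hax with rfl | hax
        · exact hh.lt hxy
        · exact B.lt_trans (B.r_lt hax) (hh.lt hxy)
    have hine : i ≠ u.length + 1 := by
      rintro rfl
      omega
    have hu : u[i - 1]'(by omega) = j := by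
      have := congrArg (fun l => l[i - 1]?) hw
      simp [show i - 1 < n by omega,
        List.getElem?_append_left (show i - 1 < u.length by omega),
        show i - 1 < u.length by omega] at this
      rw [← this, ← hσi]
      congr 1; omega
    exact hu ▸ List.getElem_mem _
  · intro i hi
    rcases Nat.eq_zero_or_pos i with rfl | hi0
    · rw [subst_of_lt _ one_pos, hS.zero, hT.zero, Set.preimage_empty]
    · obtain ⟨j, rfl⟩ := Nat.exists_eq_add_of_le hi0
      rw [subst_add, ← (hσ _ hi).2]
      simp [show j < n by omega]

/-- The Ramsey theorem for finite ordered labelled posets. -/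
theorem exists_ramsey [Finite X] [Finite Y] (A : OrderedLabelledPoset X)
    (B : OrderedLabelledPoset Y) (κ : Type) [Finite κ] :
    ∃ (Z : Type) (_ : Finite Z) (C : OrderedLabelledPoset Z), ∀ c : (X → Z) → κ,
      ∃ g, IsEmb B C g ∧ ∃ k, ∀ f, IsEmb A B f → c (g ∘ f) = k := by
  obtain ⟨m, S, hS⟩ := A.exists_isDownEnum
  obtain ⟨n, T, hT⟩ := B.exists_isDownEnum
  obtain ⟨N, hN⟩ := grahamRothschild m 1 one_pos n κ
  refine ⟨(Fin N → Bool) × ZMod 3, inferInstance, cube N, fun c => ?_⟩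
  obtain ⟨f, rfl, hrf, k, hk⟩ := hN fun w => c (A.wordMap S N w)
  refine ⟨B.wordMap T f.length f, hT.isEmb_wordMap hrf, k, fun h hh => ?_⟩
  obtain ⟨v, hv, hrv, hpre⟩ := hh.exists_preimage_word hS hT
  rw [← hk v hv hrv]
  congr 1
  funext x
  refine Prod.ext (funext fun i => ?_) (hh.lab x)
  -- Coordinate `i` asks whether `h x` avoids `T f[i]`, that is, whether `x` avoids its preimage,
  -- the down-set coded by the substituted letter.
  have hle : f[i] ≤ n := by
    have := hrf.lt _ (List.getElem_mem i.2)
    simp only [Fin.getElem_fin]; omega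
  have := hpre _ hle
  simp only [Fin.getElem_fin] at this
  simp [wordMap, this]

end OrderedLabelledPoset

namespace OrderedLabelledPoset

/-! ### The ordering property -/

/-- The disjoint union of `A` and `B`, with all elements of `A` before those of `B` in the
linear order. -/
def sum {X Y : Type*} (A : OrderedLabelledPoset X) (B : OrderedLabelledPoset Y) :
    OrderedLabelledPoset (X ⊕ Y) where
  lt := Sum.Lex A.lt B.lt
  r := Sum.LiftRel A.r B.r
  lab := Sum.elim A.lab B.lab
  isStrictTotalOrder :=
    haveI := A.isStrictTotalOrder
    haveI := B.isStrictTotalOrder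
    { }
  r_trans := by
    rintro (x | x) (y | y) (z | z) h h' <;> simp at h h' ⊢
    · exact A.r_trans h h'
    · exact B.r_trans h h'
  r_lt := by
    rintro (x | x) (y | y) h <;> simp at h ⊢
    · exact A.r_lt h
    · exact B.r_lt h

/-- Two points that are incomparable in the partial order, labelled `i` and `j`. -/
def pair (i j : ZMod 3) : OrderedLabelledPoset Bool where
  lt x y := x < y
  r _ _ := False
  lab x := bif x then j else i
  isStrictTotalOrder := inferInstance
  r_trans h _ := h.elim
  r_lt h := h.elim

/-- Two disjoint chains `0 < 3` and `1 < 2`, with lower points labelled `i` and upper points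
labelled `j`. -/
def twoChains (i j : ZMod 3) : OrderedLabelledPoset (Fin 4) where
  lt x y := x < y
  r x y := (x = 0 ∧ y = 3) ∨ (x = 1 ∧ y = 2)
  lab x := if x ≤ 1 then i else j
  isStrictTotalOrder := inferInstance
  r_trans {x y z} := by revert x y z; decide
  r_lt {x y} := by revert x y; decide

theorem isEmb_pair {X : Type*} {A : OrderedLabelledPoset X} {x y : X} (hlt : A.lt x y)
    (hr : ¬ A.r x y) : IsEmb (pair (A.lab x) (A.lab y)) A fun b => bif b then y else x := by
  have h1 : ¬ A.r y x := fun h => A.lt_irrefl _ (A.lt_trans hlt (A.r_lt h))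
  have h2 : ∀ z, ¬ A.r z z := fun z h => A.lt_irrefl _ (A.r_lt h)
  refine ⟨fun {b b'} h => ?_, fun {b b'} => ?_, fun b => ?_⟩
  · obtain ⟨rfl, rfl⟩ := Bool.lt_iff.1 h
    exact hlt
  · cases b <;> cases b' <;> simp [pair, hr, h1, h2]
  · cases b <;> rfl

/-- One label pair at a time: colour each copy of `pair i j` by whether `lt'` agrees with the given
order. On a monochromatic copy there is agreement everywhere or nowhere, and `twoChains` excludes
the latter. -/
theorem exists_isEmb_agreeing (l : List (ZMod 3 × ZMod 3)) {X : Type} [Finite X]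
    (A : OrderedLabelledPoset X) :
    ∃ (Z : Type) (_ : Finite Z) (C : OrderedLabelledPoset Z), ∀ lt' : Z → Z → Prop,
      IsStrictTotalOrder Z lt' → (∀ x y, C.r x y → lt' x y) → ∃ g, IsEmb A C g ∧
        ∀ x y, A.lt x y → ¬ A.r x y → (A.lab x, A.lab y) ∈ l → lt' (g x) (g y) := by
  induction l generalizing X with
  | nil => exact ⟨X, inferInstance, A, fun _ _ _ => ⟨id, ⟨id, Iff.rfl, fun _ => rfl⟩, by simp⟩⟩
  | cons p l ih =>
    obtain ⟨i, j⟩ := p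
    obtain ⟨Z₁, _, C₁, hC₁⟩ := exists_ramsey (pair i j) (A.sum (twoChains i j)) Prop
    obtain ⟨Z, hZ, C, hC⟩ := ih C₁
    refine ⟨Z, hZ, C, fun lt' hlt' hext => ?_⟩
    obtain ⟨g₁, hg₁, hl⟩ := hC lt' hlt' hext
    obtain ⟨g₂, hg₂, k, hk⟩ := hC₁ fun q => lt' (g₁ (q false)) (g₁ (q true))
    have hinl : IsEmb A (A.sum (twoChains i j)) Sum.inl :=
      ⟨fun h => Sum.Lex.inl h, by simp [sum], fun _ => rfl⟩
    have hpair : ∀ x y, (A.sum (twoChains i j)).lt x y → ¬ (A.sum (twoChains i j)).r x y →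
        (A.sum (twoChains i j)).lab x = i → (A.sum (twoChains i j)).lab y = j →
        lt' (g₁ (g₂ x)) (g₁ (g₂ y)) = k := by
      intro x y hlt hr hi hj
      have h := isEmb_pair hlt hr
      rw [hi, hj] at h
      exact hk _ h
    have hk : k := by
      have h02 := hpair (.inr 0) (.inr 2) (.inr (by decide : (0 : Fin 4) < 2))
        (by simp [sum, twoChains]) rfl rfl
      have h13 := hpair (.inr 1) (.inr 3) (.inr (by decide : (1 : Fin 4) < 3))
        (by simp [sum, twoChains]) rfl rfl
      have h03 := hext _ _ ((hg₁.comp hg₂).r_iff.2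
        (Sum.LiftRel.inr (by simp [twoChains]) : (A.sum (twoChains i j)).r (.inr 0) (.inr 3)))
      have h12 := hext _ _ ((hg₁.comp hg₂).r_iff.2
        (Sum.LiftRel.inr (by simp [twoChains]) : (A.sum (twoChains i j)).r (.inr 1) (.inr 2)))
      rw [← h02]
      -- Disagreement on `(0, 2)` and `(1, 3)` would give the cycle `0 < 3 < 1 < 2 < 0` in `lt'`.
      by_contra hn
      have hn' := hn
      rw [h02, ← h13] at hn'
      have hinj := (hg₁.comp hg₂).injective
      have h20 : lt' (g₁ (g₂ (.inr 2))) (g₁ (g₂ (.inr 0))) := by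
        rcases trichotomous_of lt' (g₁ (g₂ (.inr 2))) (g₁ (g₂ (.inr 0))) with h | h | h
        · exact h
        · exact absurd (hinj h) (by simp)
        · exact absurd h hn
      have h31 : lt' (g₁ (g₂ (.inr 3))) (g₁ (g₂ (.inr 1))) := by
        rcases trichotomous_of lt' (g₁ (g₂ (.inr 3))) (g₁ (g₂ (.inr 1))) with h | h | h
        · exact h
        · exact absurd (hinj h) (by simp)
        · exact absurd h hn'
      exact irrefl_of lt' _ (trans_of lt' (trans_of lt' h03 h31) (trans_of lt' h12 h20))
    refine ⟨g₁ ∘ g₂ ∘ Sum.inl, hg₁.comp (hg₂.comp hinl), fun x y hlt hr hmem => ?_⟩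
    rcases List.mem_cons.1 hmem with h | h
    · obtain ⟨h1, h2⟩ := Prod.ext_iff.1 h
      have := hpair (.inl x) (.inl y) (hinl.lt hlt) (fun h => hr (hinl.r_iff.1 h)) h1 h2
      exact this ▸ hk
    · refine hl _ _ ((hg₂.comp hinl).lt hlt) (fun h => hr ((hg₂.comp hinl).r_iff.1 h)) ?_
      rw [(hg₂.comp hinl).lab, (hg₂.comp hinl).lab]
      exact h

end OrderedLabelledPoset

/-! ### Embeddings into the generic partial order -/

theorem IsGenericPartialOrder.exists_embedding {P : Type u} [PartialOrder P] [Countable P]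
    (hP : IsGenericPartialOrder P) (Q : Type) [PartialOrder Q] [Finite Q] : Nonempty (Q ↪o P) := by
  let _ : FirstOrder.Language.order.Structure P := FirstOrder.Language.orderStructure P
  let _ : FirstOrder.Language.order.Structure (ULift.{u} Q) :=
    FirstOrder.Language.orderStructure _
  have _ : FirstOrder.Language.order.OrderedStructure P := ⟨fun _ => Iff.rfl⟩
  have _ : FirstOrder.Language.order.OrderedStructure (ULift.{u} Q) := ⟨fun _ => Iff.rfl⟩
  have h : FirstOrder.Language.IsFraisseLimit
    {M : Bundled.{u} FirstOrder.Language.order.Structure |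
      Finite M ∧ M ⊨ FirstOrder.Language.order.partialOrderTheory} P := hP
  have hQ : (Bundled.of (ULift.{u} Q) : Bundled.{u} FirstOrder.Language.order.Structure) ∈
      {M : Bundled.{u} FirstOrder.Language.order.Structure |
        Finite M ∧ M ⊨ FirstOrder.Language.order.partialOrderTheory} :=
    ⟨inferInstanceAs (Finite (ULift.{u} Q)),
      inferInstanceAs (ULift.{u} Q ⊨ FirstOrder.Language.order.partialOrderTheory)⟩
  rw [← h.age] at hQ
  obtain ⟨-, ⟨e⟩⟩ := hQ
  let e' : ULift.{u} Q ↪[FirstOrder.Language.order] P := e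
  refine ⟨⟨⟨fun x => e' ⟨x⟩, fun x y hxy => ?_⟩, fun {x y} => ?_⟩⟩
  · simpa using e'.injective hxy
  · have h := e'.map_rel FirstOrder.Language.leSymb ![⟨x⟩, ⟨y⟩]
    simp only [FirstOrder.Language.relMap_leSymb] at h
    exact h

section

variable {P : Type u} [PartialOrder P] {D : ZMod 3 → Set P}

/-- Each point is doubled to a two-element chain before embedding in `P`; density gives a point with
the right label inside each chain, and comparabilities are unchanged. -/
theorem exists_labelled_embedding [Countable P] (hP : IsGenericPartialOrder P)
    (hdense : ∀ i, IsDenseSubset (D i)) {X : Type} [Finite X] (A : OrderedLabelledPoset X) :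
    ∃ f : X → P, Function.Injective f ∧ (∀ x y, f x < f y ↔ A.r x y) ∧
      ∀ x, f x ∈ D (A.lab x) := by
  let _ : PartialOrder X :=
    { le := fun x y => x = y ∨ A.r x y
      lt := A.r
      le_refl := fun x => Or.inl rfl
      le_trans := by
        rintro x y z (rfl | h) (rfl | h')
        · exact Or.inl rfl
        · exact Or.inr h'
        · exact Or.inr h
        · exact Or.inr (A.r_trans h h')
      le_antisymm := by
        rintro x y (rfl | h) (h' | h')
        · rfl
        · rfl
        · exact h'.symm
        · exact absurd (A.r_lt (A.r_trans h h')) (A.lt_irrefl _)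
      lt_iff_le_not_ge := by
        intro x y
        constructor
        · intro h
          refine ⟨Or.inr h, ?_⟩
          rintro (rfl | h')
          · exact A.lt_irrefl _ (A.r_lt h)
          · exact A.lt_irrefl _ (A.r_lt (A.r_trans h h'))
        · rintro ⟨rfl | h, h'⟩
          · exact absurd (Or.inl rfl) h'
          · exact h }
  have : Finite (X ×ₗ Bool) := inferInstanceAs (Finite (X × Bool))
  obtain ⟨e⟩ := hP.exists_embedding (X ×ₗ Bool)
  have hbet : ∀ x, ∃ y ∈ D (A.lab x), e (toLex (x, false)) < y ∧ y < e (toLex (x, true)) :=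
    fun x => hdense _ _ _ (e.lt_iff_lt.2 (Prod.Lex.toLex_lt_toLex.2 (Or.inr ⟨rfl, by simp⟩)))
  choose f hfD hf0 hf1 using hbet
  have hmono : ∀ x y, A.r x y → f x < f y := fun x y h =>
    (hf1 x).trans ((e.lt_iff_lt.2 (Prod.Lex.toLex_lt_toLex.2 (Or.inl h))).trans (hf0 y))
  have hle : ∀ x y, f x ≤ f y → x = y ∨ A.r x y := by
    intro x y h
    have := e.lt_iff_lt.1 ((hf0 x).trans_le (h.trans (hf1 y).le))
    rcases Prod.Lex.toLex_lt_toLex.1 this with h | h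
    · exact Or.inr h
    · exact Or.inl h.1
  refine ⟨f, fun x y h => ?_, fun x y => ⟨fun h => ?_, hmono x y⟩, hfD⟩
  · rcases hle x y h.le with h' | h'
    · exact h'
    · exact absurd h (hmono x y h').ne
  · rcases hle x y h.le with rfl | h'
    · exact absurd h (lt_irrefl _)
    · exact h'

/-- A linear extension of the order of `P` and a partition of `P`, as an ordered labelled poset. -/
noncomputable def partitionedPoset (hpart : ∀ x : P, ∃! i, x ∈ D i) (lt : P → P → Prop)
    (hlt : IsStrictTotalOrder P lt) (hext : ∀ x y : P, x < y → lt x y) :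
    OrderedLabelledPoset P where
  lt := lt
  r x y := x < y
  lab x := (hpart x).choose
  isStrictTotalOrder := hlt
  r_trans h h' := h.trans h'
  r_lt h := hext _ _ h

variable {hpart : ∀ x : P, ∃! i, x ∈ D i} {lt : P → P → Prop} {hlt : IsStrictTotalOrder P lt}
  {hext : ∀ x y : P, x < y → lt x y}

theorem partitionedPoset_mem (x : P) : x ∈ D ((partitionedPoset hpart lt hlt hext).lab x) :=
  (hpart x).choose_spec.1

theorem partitionedPoset_lab_eq_iff {x : P} {i : ZMod 3} :
    (partitionedPoset hpart lt hlt hext).lab x = i ↔ x ∈ D i :=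
  ⟨fun h => h ▸ partitionedPoset_mem x, fun h => (hpart x).unique (partitionedPoset_mem x) h⟩

/-- Every finite ordered labelled poset embeds, whatever the linear extension is. -/
theorem exists_isEmb_partitionedPoset [Countable P] (hP : IsGenericPartialOrder P)
    (hdense : ∀ i, IsDenseSubset (D i)) {X : Type} [Finite X] (A : OrderedLabelledPoset X) :
    ∃ f, A.IsEmb (partitionedPoset hpart lt hlt hext) f := by
  obtain ⟨Z, _, C, hC⟩ := A.exists_isEmb_agreeing Finset.univ.toList
  obtain ⟨f, hf, hfr, hfD⟩ := exists_labelled_embedding hP hdense C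
  -- Pulled back along `f`, `lt` is just some linear extension of `C.r`, which is all that `hC`
  -- requires.
  obtain ⟨g, hg, hgl⟩ := hC (fun x y => lt (f x) (f y))
    (RelEmbedding.preimage ⟨f, hf⟩ lt).isStrictTotalOrder
    fun x y h => hext _ _ ((hfr x y).2 h)
  refine ⟨f ∘ g, fun {x y} h => ?_, (hfr _ _).trans hg.r_iff, fun x => ?_⟩
  · by_cases hr : A.r x y
    · exact hext _ _ ((hfr _ _).2 (hg.r_iff.2 hr))
    · exact hgl x y h hr (by simp)
  · rw [← hg.lab]
    exact partitionedPoset_lab_eq_iff.2 (hfD _)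

/-! ### Transfer to `P3Star` -/

theorem TRel_congr {V W : Type u} {R : V → V → Prop} {R' : W → W → Prop} {x y : V} {x' y' : W}
    (h1 : R x y ↔ R' x' y') (h2 : R y x ↔ R' y' x') (k : ZMod 3) :
    TRel R k x y ↔ TRel R' k x' y' := by
  simp only [TRel, h1, h2]

theorem TRel_neg_one {V : Type u} {R : V → V → Prop} {x y : V} : TRel R (-1) x y ↔ R x y := by
  simp [TRel, show (-1 : ZMod 3) ≠ 1 by decide, show (-1 : ZMod 3) ≠ 0 by decide]

theorem P3_adj_iff (hpart : ∀ x : P, ∃! i, x ∈ D i) {x y : P} {i j : ZMod 3} (hx : x ∈ D i)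
    (hy : y ∈ D j) : (P3 D).Adj x y ↔ TRel (fun a b : P => a < b) (-1 - (j - i)) x y := by
  rw [← P3_spec hpart hx hy, sub_add_cancel, TRel_neg_one]

theorem lt_iff_TRel_P3 (hpart : ∀ x : P, ∃! i, x ∈ D i) {x y : P} {i j : ZMod 3} (hx : x ∈ D i)
    (hy : y ∈ D j) : x < y ↔ TRel (P3 D).Adj (-1 + (j - i)) x y := by
  rw [P3_spec hpart hx hy, TRel_neg_one]

/-- The relations of `P3Star` determine, and are determined by, the ordered labelled poset. -/
theorem P3Star_relMap_iff {ι : Type*} {a b : ι → P} :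
    (∀ (n : ℕ) (r : P3StarLang.Relations n) (v : Fin n → ι),
      FirstOrder.Language.Structure.RelMap (M := P3Star D lt) r (a ∘ v) ↔
        FirstOrder.Language.Structure.RelMap (M := P3Star D lt) r (b ∘ v)) ↔
    (∀ x y, lt (a x) (a y) ↔ lt (b x) (b y)) ∧ (∀ x y, a x < a y ↔ b x < b y) ∧
      ∀ x, (partitionedPoset hpart lt hlt hext).lab (a x) =
        (partitionedPoset hpart lt hlt hext).lab (b x) := by
  have mem : ∀ x, x ∈ D ((partitionedPoset hpart lt hlt hext).lab x) := partitionedPoset_mem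
  constructor
  · intro h
    have hlab : ∀ x, (partitionedPoset hpart lt hlt hext).lab (a x) =
        (partitionedPoset hpart lt hlt hext).lab (b x) := fun x =>
      (partitionedPoset_lab_eq_iff.2 ((h 1
        (.part ((partitionedPoset hpart lt hlt hext).lab (a x))) fun _ => x).1 (mem (a x)))).symm
    have hadj : ∀ x y, (P3 D).Adj (a x) (a y) ↔ (P3 D).Adj (b x) (b y) := fun x y =>
      h 2 .edge ![x, y]
    refine ⟨fun x y => h 2 .lt ![x, y], fun x y => ?_, hlab⟩
    rw [lt_iff_TRel_P3 hpart (mem (a x)) (mem (a y)), lt_iff_TRel_P3 hpart (mem (b x)) (mem (b y)),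
      hlab, hlab]
    exact TRel_congr (hadj x y) (hadj y x) _
  · rintro ⟨h1, h2, h3⟩ n r v
    cases r with
    | edge =>
      change (P3 D).Adj (a (v 0)) (a (v 1)) ↔ (P3 D).Adj (b (v 0)) (b (v 1))
      rw [P3_adj_iff hpart (mem (a (v 0))) (mem (a (v 1))),
        P3_adj_iff hpart (mem (b (v 0))) (mem (b (v 1))), h3, h3]
      exact TRel_congr (h2 _ _) (h2 _ _) _
    | part i =>
      change a (v 0) ∈ D i ↔ b (v 0) ∈ D i
      rw [← partitionedPoset_lab_eq_iff (hpart := hpart) (hlt := hlt) (hext := hext), h3,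
        partitionedPoset_lab_eq_iff]
    | lt => exact h1 _ _

end

/-! ### The Ramsey property of the age -/

/-- The structure induced by `P3Star` along a map. -/
def inducedStar {P : Type u} [PartialOrder P] (D : ZMod 3 → Set P) (lt : P → P → Prop) {Z : Type}
    (φ : Z → P) : Bundled.{u} P3StarLang.Structure :=
  ⟨ULift.{u} Z,
    { funMap := fun f _ => nomatch f
      RelMap := fun r v => FirstOrder.Language.Structure.RelMap (M := P3Star D lt) r
        (φ ∘ ULift.down ∘ v) }⟩

instance : P3StarLang.IsRelational := fun _ => inferInstanceAs (IsEmpty Empty)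

theorem mainTheorem3 {P : Type u} [PartialOrder P] [Countable P]
    (hP : IsGenericPartialOrder P)
    (D : ZMod 3 → Set P) (hpart : ∀ x : P, ∃! i, x ∈ D i) (hdense : ∀ i, IsDenseSubset (D i))
    (lt : P → P → Prop) [IsStrictTotalOrder P lt] (hext : ∀ x y : P, x < y → lt x y)
    (hhom : P3StarLang.IsUltrahomogeneous (P3Star D lt)) :
    RamseyProperty P3StarLang (P3StarLang.age (P3Star D lt)) := by
  classical
  rintro k A ⟨hA, ⟨eA⟩⟩ B ⟨hB, ⟨eB⟩⟩
  have := hA.finite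
  have := hB.finite
  let Q := partitionedPoset hpart lt inferInstance hext
  obtain ⟨Z, _, C₀, hC₀⟩ := OrderedLabelledPoset.exists_ramsey
    (Q.comap eA eA.injective) (Q.comap eB eB.injective) (Option (Fin k))
  obtain ⟨φ, hφ⟩ : ∃ φ, C₀.IsEmb Q φ := exists_isEmb_partitionedPoset hP hdense C₀
  let eC : inducedStar D lt φ ↪[P3StarLang] P3Star D lt :=
    { toFun := φ ∘ ULift.down
      inj' := hφ.injective.comp ULift.down_injective
      map_fun' := fun f _ => nomatch f
      map_rel' := fun _ _ => Iff.rfl }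
  have hCfin : Finite (inducedStar D lt φ) := inferInstanceAs (Finite (ULift.{u} Z))
  have lift : ∀ {M : Bundled.{u} P3StarLang.Structure} (eM : M ↪[P3StarLang] P3Star D lt)
      (q : M → Z), (Q.comap eM eM.injective).IsEmb C₀ q →
      ∃ e : M ↪[P3StarLang] inducedStar D lt φ, ∀ x, e x = ULift.up (q x) := by
    intro M eM q hq
    have hq' := hφ.comp hq
    have h := (P3Star_relMap_iff (hpart := hpart) (hlt := inferInstance) (hext := hext)
      (a := φ ∘ q) (b := eM)).2
      ⟨fun _ _ => hq'.lt_iff, fun _ _ => hq'.r_iff, hq'.lab⟩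
    exact ⟨{ toFun := fun x => ULift.up (q x)
             inj' := ULift.up_injective.comp hq.injective
             map_fun' := fun f _ => nomatch f
             map_rel' := fun r v => (h _ r v).trans (eM.map_rel r v) }, fun _ => rfl⟩
  refine ⟨inducedStar D lt φ, ⟨FirstOrder.Language.Structure.fg_iff_finite.2 hCfin, ⟨eC⟩⟩, fun c => ?_⟩
  have hcopy : ∀ {M : Bundled.{u} P3StarLang.Structure} (e : M ↪[P3StarLang] inducedStar D lt φ),
      e.toHom.range ∈ copies P3StarLang M (inducedStar D lt φ) := fun e => ⟨e.equivRange⟩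
  -- A colouring of copies becomes one of maps; `none` marks maps that are not embeddings.
  obtain ⟨g, hg, κ, hκ⟩ := hC₀ fun q =>
    if h : ∃ e : A ↪[P3StarLang] inducedStar D lt φ, ∀ x, e x = ULift.up (q x) then
      some (c ⟨h.choose.toHom.range, hcopy _⟩) else none
  obtain ⟨e, he⟩ := lift eB g hg
  refine ⟨e.toHom.range, hcopy e, ?_⟩
  have hcol : ∀ A' : copies P3StarLang A (inducedStar D lt φ), (A' : P3StarLang.Substructure (inducedStar D lt φ)) ≤ e.toHom.range →
      some (c A') = κ := by
    rintro ⟨S, ⟨θ⟩⟩ hS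
    -- A copy of `A` in the range of `e` is pulled back along `e` to an embedding in `B`.
    let ι : A ↪[P3StarLang] B := e.equivRange.symm.toEmbedding.comp
      ((FirstOrder.Language.Substructure.inclusion hS).comp θ.toEmbedding)
    have heι : ∀ x, e (ι x) = (θ x : inducedStar D lt φ) := by
      intro x
      rw [← FirstOrder.Language.Embedding.equivRange_apply]
      simp [ι]
    have hι : (Q.comap eA eA.injective).IsEmb (Q.comap eB eB.injective) ι := by
      have h := (P3Star_relMap_iff (hpart := hpart) (hlt := inferInstance) (hext := hext)
        (lt := lt) (a := eB ∘ ι) (b := eA)).1 fun n r v => by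
          have h1 := (eB.comp ι).map_rel r v
          have h2 := eA.map_rel r v
          exact h1.trans h2.symm
      exact ⟨fun {x y} hxy => (h.1 x y).2 hxy, fun {x y} => h.2.1 x y, h.2.2⟩
    have hex : ∃ e' : A ↪[P3StarLang] inducedStar D lt φ, ∀ x, e' x = ULift.up ((g ∘ ι) x) :=
      ⟨e.comp ι, fun x => he (ι x)⟩
    have h := hκ ι hι
    rw [dif_pos hex] at h
    rw [← h]
    congr 3
    ext z
    rw [FirstOrder.Language.Hom.mem_range]
    -- The chosen embedding agrees pointwise with `θ`, so its range is `S`.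
    have hval : ∀ x, hex.choose.toHom x = (θ x : inducedStar D lt φ) := fun x =>
      (hex.choose_spec x).trans ((he (ι x)).symm.trans (heι x))
    simp only [hval]
    constructor
    · intro hz
      exact ⟨θ.symm ⟨z, hz⟩, by simp⟩
    · rintro ⟨x, rfl⟩
      exact (θ x).2
  refine Set.encard_le_one_iff.2 ?_
  rintro _ _ ⟨A₁, h₁, rfl⟩ ⟨A₂, h₂, rfl⟩
  exact Option.some_injective _ ((hcol A₁ h₁).trans (hcol A₂ h₂).symm)
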